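/- A sequence of positive integers $(a_1,\dots,a_s)$ with $a_1+\dots+a_s=n$ is a strongly unimodal sequence of size $n$ if $a_1<\dots<a_{k-1}<a_k>a_{k+1}>\dots>a_s$ for some $1\le k\le s$; its rank is $s-2k+1$, the number of terms after the peak minus the number of terms before it. Let $u(m,n)$ be the number of strongly unimodal sequences of size $n$ and rank $m$, let $p(n)$ be the number of partitions of $n$, and let $(q)_\infty=\prod_{j\ge1}(1-q^j)$. Then for every integer $m\ge0$, $$U_m(q):=\sum_{n\ge1}u(m,n)q^n=\frac{q^{m(m+1)/2}}{(q)_\infty}\sum_{n\ge1}\frac{(-1)^n q^{\frac{n(n+1)}2+mn}}{1-q^{n+m}}\left(q^{n(n+m)}-1\right),$$ both as an identity of formal power series in $q$ and as an identity for all complex $q$ with $|q|<1$ (all series and products being convergent, and $(q)_\infty$ being invertible, respectively nonzero). In particular, $u\!\left(m,\tfrac{(m+1)(m+2)}2+n\right)=p(n)$ for $0\le n\le m+1$. -/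

import Mathlib

open scoped PowerSeries PowerSeries.WithPiTopology

namespace StronglyUnimodal

/-- `c = (a₁, …, a_s)` is a finite sequence of positive integers with sum `n`. The term at (zero-based)
position `k` is a strict peak: `a₁ < ⋯ < a_{k-1} < a_k > a_{k+1} > ⋯ > a_s`. -/
def IsPeak {n : ℕ} (c : Composition n) (k : Fin c.length) : Prop :=
  StrictMonoOn c.blocksFun (Set.Iic k) ∧ StrictAntiOn c.blocksFun (Set.Ici k)

/-- `c` is strongly unimodal of rank `r`: the number of terms after the peak minus the number of
terms before the peak is `r`. The peak of a strongly unimodal sequence is unique. -/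
def HasRank {n : ℕ} (c : Composition n) (r : ℤ) : Prop :=
  ∃ k : Fin c.length, IsPeak c k ∧ r = ((c.length : ℤ) - 1 - (k : ℕ)) - (k : ℕ)

/-- `u(m, n)`: the number of strongly unimodal sequences of size `n` and rank `m`. -/
noncomputable def u (m : ℤ) (n : ℕ) : ℕ :=
  Nat.card {c : Composition n // HasRank c m}

/-- There is no strongly unimodal sequence of size `0`. -/
theorem u_zero (m : ℤ) : u m 0 = 0 := by
  have : IsEmpty {c : Composition 0 // HasRank c m} := by
    refine ⟨fun ⟨c, k, _⟩ => ?_⟩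
    have h1 := c.length_le
    have h2 := k.isLt
    omega
  exact Nat.card_of_isEmpty

/-- The formal generating function `U_m(q) = ∑_{n ≥ 1} u(m, n) qⁿ` (recall `u(m, 0) = 0`). -/
noncomputable def U (m : ℤ) : ℤ⟦X⟧ := PowerSeries.mk fun n => (u m n : ℤ)

/-- `(a; q)_∞ = ∏_{j ≥ 0} (1 - a q^j)`. -/
noncomputable def qPochInf {R : Type*} [CommRing R] [TopologicalSpace R] (a q : R) : R :=
  ∏' j : ℕ, (1 - a * q ^ j)

end StronglyUnimodal

open StronglyUnimodal

namespace StronglyUnimodal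

open PowerSeries Filter Topology

/-! A sequence with peak `N + 1` is a pair of subsets of `{1, …, N}`, so `U m` is the sum over `N`
of `q^(N+1)` times the `z^m` coefficient of `∏_{j ≤ N} (1 + z q^j)(1 + z⁻¹ q^j)`. Multiplying by `1
+ z⁻¹` adds the coefficients at `m` and `m + 1` and completes the product to one that the finite
Jacobi triple product expands (`pairSeries_add`). Hence `U m + U (m + 1)` is a monomial times
`binomSeries (2 * m + 1)` (`U_add`).

Times `(q)_∞`, that series is a partial theta function (`qPochInf_mul_binomSeries`), which also
governs the sum of neighbouring Appell-type series (`appellSeries_add`). So `D_m = (q)_∞ U_m -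
q^(m(m+1)/2) S_m`, with `S_m` the Appell-type series, satisfies `D_m = -D_{m+1}`. As `q^m` divides
`D_m`, every power of `q` divides it, and `D_m = 0` (`qPochInf_mul_U`).

For complex `q`, the three factors of `U_eq` are shown to converge absolutely and are evaluated
separately. -/

/-! ### Gaussian binomials and finite `q`-factorials. -/

/-- The Gaussian binomial coefficient `[n; k]` as a formal power series in `q`. -/
noncomputable def qbinom : ℕ → ℕ → ℤ⟦X⟧
  | _, 0 => 1
  | 0, _ + 1 => 0
  | n + 1, k + 1 => qbinom n k + X ^ (k + 1) * qbinom n (k + 1)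

@[simp] theorem qbinom_zero_right (n : ℕ) : qbinom n 0 = 1 := by cases n <;> rfl

theorem qbinom_succ_succ (n k : ℕ) :
    qbinom (n + 1) (k + 1) = qbinom n k + X ^ (k + 1) * qbinom n (k + 1) := rfl

theorem qbinom_eq_zero_of_lt {n k : ℕ} (h : n < k) : qbinom n k = 0 := by
  induction n generalizing k with
  | zero => obtain ⟨k, rfl⟩ := Nat.exists_eq_add_one_of_ne_zero (by omega : k ≠ 0); rfl
  | succ n ih =>
    obtain ⟨k, rfl⟩ := Nat.exists_eq_add_one_of_ne_zero (by omega : k ≠ 0)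
    rw [qbinom_succ_succ, ih (by omega), ih (by omega)]; simp

@[simp] theorem qbinom_self (n : ℕ) : qbinom n n = 1 := by
  induction n with
  | zero => rfl
  | succ n ih => rw [qbinom_succ_succ, ih, qbinom_eq_zero_of_lt (by omega)]; simp

/-- The finite product `(q; q)_n`. -/
noncomputable def qfac (n : ℕ) : ℤ⟦X⟧ := ∏ j ∈ Finset.range n, (1 - X * X ^ j)

theorem qfac_succ (n : ℕ) : qfac (n + 1) = qfac n * (1 - X ^ (n + 1)) := by
  rw [qfac, Finset.prod_range_succ, ← pow_succ', qfac]

theorem qfac_ne_zero (n : ℕ) : qfac n ≠ 0 := by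
  refine Finset.prod_ne_zero_iff.2 fun j _ h => ?_
  have := congrArg (constantCoeff (R := ℤ)) h
  simp at this

/-- Pascal's rule reduces `(j + 1, k + 1)` to `(j + 1, k)` and `(j, k + 1)`, hence the nested
induction. -/
theorem qbinom_mul_qfac (j k : ℕ) : qbinom (j + k) k * (qfac j * qfac k) = qfac (j + k) := by
  induction k generalizing j with
  | zero => simp [qfac]
  | succ k ihk =>
    induction j with
    | zero => simp [qfac]
    | succ j ihj =>
      have h1 := ihk (j + 1)
      have e : j + 1 + (k + 1) = (j + 1 + k) + 1 := by ring
      have e' : j + (k + 1) = j + 1 + k := by ring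
      rw [e'] at ihj
      rw [e, qbinom_succ_succ, qfac_succ (j + 1 + k), qfac_succ k]
      rw [qfac_succ k] at ihj
      have h2 : qbinom (j + 1 + k) (k + 1) * (qfac (j + 1) * (qfac k * (1 - X ^ (k + 1))))
          = qfac (j + 1 + k) * (1 - X ^ (j + 1)) := by
        rw [qfac_succ j, ← ihj]; ring
      calc _ = qbinom (j + 1 + k) k * (qfac (j + 1) * qfac k) * (1 - X ^ (k + 1)) +
            X ^ (k + 1) * (qbinom (j + 1 + k) (k + 1) *
              (qfac (j + 1) * (qfac k * (1 - X ^ (k + 1))))) := by ring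
        _ = _ := by rw [h1, h2]; ring

theorem qbinom_symm (j k : ℕ) : qbinom (j + k) k = qbinom (j + k) j := by
  refine mul_right_cancel₀ (mul_ne_zero (qfac_ne_zero j) (qfac_ne_zero k)) ?_
  rw [qbinom_mul_qfac, add_comm j k, mul_comm (qfac j), qbinom_mul_qfac]

/-- The other Pascal rule: the defining one reflected by `qbinom_symm`. -/
theorem qbinom_succ_succ' (j k : ℕ) :
    qbinom (j + k + 1) (k + 1) = qbinom (j + k) (k + 1) + X ^ j * qbinom (j + k) k := by
  rcases j with _ | j
  · simp [qbinom_eq_zero_of_lt]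
  · have h1 := qbinom_symm (j + 1) (k + 1)
    have e : j + 1 + (k + 1) = j + 1 + k + 1 := by ring
    rw [e] at h1
    have h2 := qbinom_symm (j + 1) k
    have h3 := qbinom_symm j (k + 1)
    have e' : j + (k + 1) = j + 1 + k := by ring
    rw [e'] at h3
    rw [h1, h2, h3, qbinom_succ_succ]

/-! ### The infinite product and `X`-adic convergence. -/

theorem multipliable_qPochInf : Multipliable fun j : ℕ => 1 - (X : ℤ⟦X⟧) * X ^ j := by
  simpa only [pow_succ'] using WithPiTopology.multipliable_one_sub_X_pow ℤ

theorem qPochInf_X_ne_zero : qPochInf (X : ℤ⟦X⟧) X ≠ 0 := by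
  simpa only [qPochInf, pow_succ'] using WithPiTopology.tprod_one_sub_X_pow_ne_zero ℤ

theorem tendsto_qfac : Tendsto qfac atTop (𝓝 (qPochInf X X)) :=
  multipliable_qPochInf.hasProd.tendsto_prod_nat

/-- A series whose `n`-th term is divisible by `X ^ n` converges. -/
theorem summable_of_X_pow_dvd {f : ℕ → ℤ⟦X⟧} (h : ∀ n, X ^ n ∣ f n) : Summable f := by
  rw [WithPiTopology.summable_iff_summable_coeff]
  intro d
  refine summable_of_hasFiniteSupport ((Set.finite_Iic d).subset fun n hn => ?_)
  by_contra hd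
  exact hn (X_pow_dvd_iff.1 (h n) d (by simpa using hd))

theorem eq_zero_of_forall_X_pow_dvd {f : ℤ⟦X⟧} (h : ∀ n, X ^ n ∣ f) : f = 0 := by
  ext d
  simpa using X_pow_dvd_iff.1 (h (d + 1)) d (by omega)

/-! ### The binomial series as a partial theta function. -/

/-- `∑_k q^k [a + 2k; k]`. -/
noncomputable def binomSeries (a : ℕ) : ℤ⟦X⟧ := ∑' k : ℕ, X ^ k * qbinom (a + 2 * k) k

theorem summable_binomSeries (a : ℕ) : Summable fun k : ℕ => X ^ k * qbinom (a + 2 * k) k :=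
  summable_of_X_pow_dvd fun _ => dvd_mul_right _ _

/-- The two Pascal rules, applied in turn to the right side at `K + 1`, split off exactly one new
term of each sum. -/
theorem sum_binomSeries_telescope (a K : ℕ) :
    ∑ k ∈ Finset.range (K + 1), X ^ k * qbinom (a + 2 * k) k +
      X ^ (a + 3) * ∑ k ∈ Finset.range K, X ^ k * qbinom (a + 3 + 2 * k) k =
      qbinom (a + 2 + 2 * K) K := by
  induction K with
  | zero => simp
  | succ K ih =>
    rw [Finset.sum_range_succ, Finset.sum_range_succ (fun k => X ^ k * qbinom (a + 3 + 2 * k) k)]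
    have h1 := qbinom_succ_succ (a + 2 * (K + 1)) K
    have h2 := qbinom_succ_succ' (a + 3 + K) K
    have e1 : a + 2 * (K + 1) = a + 2 + 2 * K := by ring
    have e2 : a + 3 + K + K = a + 2 + 2 * K + 1 := by ring
    have e3 : a + 2 + 2 * (K + 1) = a + 2 + 2 * K + 1 + 1 := by ring
    have e4 : a + 3 + 2 * K = a + 2 + 2 * K + 1 := by ring
    rw [e1] at h1 ⊢
    rw [e2] at h2
    rw [e3, e4, h2, h1, ← ih]
    ring

/-- The limit `K → ∞` of the telescoped identity, since `[a + 2 + 2K; K]` tends to `1 / (q)_∞`;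
clearing denominators avoids division. -/
theorem qPochInf_mul_binomSeries_add (a : ℕ) :
    qPochInf X X * (binomSeries a + X ^ (a + 3) * binomSeries (a + 3)) = 1 := by
  have h1 : Tendsto (fun K => (qbinom (a + 2 + 2 * K) K) * (qfac (a + 2 + K) * qfac K)) atTop
      (𝓝 ((binomSeries a + X ^ (a + 3) * binomSeries (a + 3)) *
        (qPochInf X X * qPochInf X X))) := by
    refine Tendsto.mul ((tendsto_congr (sum_binomSeries_telescope a)).1 (Tendsto.add ?_
      (Tendsto.mul tendsto_const_nhds ?_))) (Tendsto.mul ?_ ?_)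
    · exact (summable_binomSeries a).hasSum.tendsto_sum_nat.comp (tendsto_add_atTop_nat 1)
    · exact (summable_binomSeries (a + 3)).hasSum.tendsto_sum_nat
    · exact tendsto_qfac.comp (tendsto_atTop_mono (fun n => by simp) tendsto_id)
    · exact tendsto_qfac
  have h2 : Tendsto (fun K => (qbinom (a + 2 + 2 * K) K) * (qfac (a + 2 + K) * qfac K)) atTop
      (𝓝 (qPochInf X X)) := by
    have : ∀ K, (qbinom (a + 2 + 2 * K) K) * (qfac (a + 2 + K) * qfac K) = qfac (a + 2 + 2 * K) := by
      intro K
      have := qbinom_mul_qfac (a + 2 + K) K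
      rwa [show a + 2 + K + K = a + 2 + 2 * K by ring] at this
    simp_rw [this]
    exact tendsto_qfac.comp (tendsto_atTop_mono (fun n => by simp only [id]; omega) tendsto_id)
  have h3 := tendsto_nhds_unique h1 h2
  refine mul_right_cancel₀ qPochInf_X_ne_zero ?_
  rw [one_mul]
  linear_combination h3

/-- The partial theta series `∑_n (-1)^n q^(3n(n+1)/2 + an)`. -/
noncomputable def partialTheta (a : ℕ) : ℤ⟦X⟧ :=
  ∑' n : ℕ, (-1) ^ n * X ^ (3 * (n * (n + 1) / 2) + a * n)

theorem triangle_succ (n : ℕ) : (n + 1) * (n + 2) / 2 = n * (n + 1) / 2 + (n + 1) := by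
  rw [show (n + 1) * (n + 2) = n * (n + 1) + (n + 1) * 2 by ring, Nat.add_mul_div_right _ _ two_pos]

theorem le_triangle (n : ℕ) : n ≤ n * (n + 1) / 2 := by
  cases n with
  | zero => simp
  | succ n => rw [triangle_succ]; omega

theorem summable_partialTheta (a : ℕ) :
    Summable fun n : ℕ => (-1 : ℤ⟦X⟧) ^ n * X ^ (3 * (n * (n + 1) / 2) + a * n) :=
  summable_of_X_pow_dvd fun n => Dvd.dvd.mul_left (pow_dvd_pow _ (by
    have := le_triangle n; omega)) _

theorem partialTheta_eq (a : ℕ) :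
    partialTheta a = 1 - X ^ (a + 3) * partialTheta (a + 3) := by
  rw [partialTheta, (summable_partialTheta a).tsum_eq_zero_add, partialTheta,
    ← (summable_partialTheta (a + 3)).tsum_mul_left, sub_eq_add_neg, ← tsum_neg]
  congr 1
  · simp
  · refine tsum_congr fun n => ?_
    rw [triangle_succ, show 3 * (n * (n + 1) / 2 + (n + 1)) + a * (n + 1) =
      (a + 3) + (3 * (n * (n + 1) / 2) + (a + 3) * n) by ring]
    ring

/-- Both sides solve `F(a) = 1 - q^(a+3) F(a+3)`; each iteration makes their difference divisible by
a further power of `q`. -/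
theorem qPochInf_mul_binomSeries (a : ℕ) : qPochInf X X * binomSeries a = partialTheta a := by
  have key : ∀ n a, X ^ n ∣ qPochInf X X * binomSeries a - partialTheta a := by
    intro n
    induction n with
    | zero => simp
    | succ n ih =>
      intro a
      have : qPochInf X X * binomSeries a - partialTheta a = -(X * X ^ (a + 2) *
          (qPochInf X X * binomSeries (a + 3) - partialTheta (a + 3))) := by
        rw [partialTheta_eq a]
        linear_combination qPochInf_mul_binomSeries_add a
      rw [this, dvd_neg, pow_succ', mul_assoc]
      exact mul_dvd_mul_left _ ((ih _).mul_left _)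
  exact sub_eq_zero.1 (eq_zero_of_forall_X_pow_dvd fun n => key n a)

/-! ### The Appell-type series. -/

/-- The polynomial `(-1)^N q^(N(N+1)/2 + mN) (q^(N(N+m)) - 1) / (1 - q^(N+m))` at `N = n + 1`. -/
noncomputable def appellTerm (m n : ℕ) : ℤ⟦X⟧ :=
  (-1) ^ n * ∑ j ∈ Finset.range (n + 1), X ^ ((n + 1) * (n + 2) / 2 + m * (n + 1) + j * (n + 1 + m))

/-- The sum of the series `appellTerm m`. -/
noncomputable def appellSeries (m : ℕ) : ℤ⟦X⟧ := ∑' n, appellTerm m n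

theorem X_pow_dvd_appellTerm (m n : ℕ) :
    X ^ ((n + 1) * (n + 2) / 2 + m * (n + 1)) ∣ appellTerm m n :=
  (Finset.dvd_sum fun _ _ => pow_dvd_pow _ (by omega)).mul_left _

theorem summable_appellTerm (m : ℕ) : Summable (appellTerm m) :=
  summable_of_X_pow_dvd fun n => (pow_dvd_pow _ (by
    have := le_triangle (n + 1); simp only [add_assoc] at this; norm_num at this; omega)).trans
      (X_pow_dvd_appellTerm m n)

theorem appellTerm_zero (m : ℕ) : appellTerm m 0 = X ^ (m + 1) := by
  simp [appellTerm, add_comm]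

/-- The shifted term cancels every summand of `appellTerm m (n + 1)` except the last, `j = n + 1`.
-/
theorem appellTerm_succ_add (m n : ℕ) :
    appellTerm m (n + 1) + X ^ (m + 1) * appellTerm (m + 1) n =
      X ^ (m + 1) * ((-1) ^ (n + 1) * X ^ (3 * ((n + 1) * (n + 1 + 1) / 2) + (2 * m + 1) * (n + 1)))
      := by
  have h : X ^ (m + 1) * appellTerm (m + 1) n = (-1) ^ n * ∑ j ∈ Finset.range (n + 1),
      X ^ ((n + 1 + 1) * (n + 1 + 2) / 2 + m * (n + 1 + 1) + j * (n + 1 + 1 + m)) := by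
    rw [appellTerm, mul_left_comm, Finset.mul_sum]
    congr 1
    refine Finset.sum_congr rfl fun j _ => ?_
    rw [← pow_add, triangle_succ (n + 1)]
    congr 1
    ring
  rw [h, appellTerm, Finset.sum_range_succ, triangle_succ (n + 1)]
  have e : (n + 1) * (n + 1 + 1) / 2 + (n + 1 + 1) + m * (n + 1 + 1) + (n + 1) * (n + 1 + 1 + m) =
      (m + 1) + (3 * ((n + 1) * (n + 1 + 1) / 2) + (2 * m + 1) * (n + 1)) := by
    have : 2 * ((n + 1) * (n + 1 + 1) / 2) = (n + 1) * (n + 1 + 1) :=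
      Nat.mul_div_cancel' (Nat.even_mul_succ_self (n + 1)).two_dvd
    linarith
  rw [e]
  ring

theorem appellSeries_add (m : ℕ) :
    appellSeries m + X ^ (m + 1) * appellSeries (m + 1) =
      X ^ (m + 1) * partialTheta (2 * m + 1) := by
  rw [appellSeries, (summable_appellTerm m).tsum_eq_zero_add, appellSeries, partialTheta,
    ← (summable_appellTerm (m + 1)).tsum_mul_left, ← (summable_partialTheta _).tsum_mul_left,
    add_assoc, ← Summable.tsum_add ((summable_nat_add_iff 1).2 (summable_appellTerm m))
      ((summable_appellTerm (m + 1)).mul_left _),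
    ((summable_partialTheta _).mul_left _).tsum_eq_zero_add]
  simp_rw [appellTerm_succ_add, appellTerm_zero]
  simp

/-! ### Strongly unimodal sequences as a peak and two sets. -/

theorem isPeak_iff {n : ℕ} (c : Composition n) {l₁ l₂ : List ℕ} {p : ℕ}
    (h : c.blocks = l₁ ++ p :: l₂) (k : Fin c.length) (hk : (k : ℕ) = l₁.length) :
    IsPeak c k ↔ (l₁ ++ [p]).Pairwise (· < ·) ∧ (p :: l₂).Pairwise (· > ·) := by
  have hlen : c.length = l₁.length + 1 + l₂.length := by
    rw [← c.blocks_length, h]; simp; ring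
  have hlen' := c.blocks_length
  have hf : ∀ i : Fin c.length, c.blocksFun i = (l₁ ++ p :: l₂)[(i : ℕ)]'(by
      have := i.2; simp; omega) := fun i => by
    simp only [Composition.blocksFun, List.get_eq_getElem, h]
  have e : l₁ ++ [p] = (l₁ ++ p :: l₂).take (l₁.length + 1) := by simp [List.take_append]
  have e' : p :: l₂ = (l₁ ++ p :: l₂).drop l₁.length := by simp
  refine and_congr ?_ ?_
  · rw [e, List.pairwise_iff_getElem]
    constructor
    · intro H i j hi hj hij
      simp only [List.length_take, lt_min_iff, List.length_append, List.length_cons] at hi hj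
      have := H (a := ⟨i, by omega⟩) (b := ⟨j, by omega⟩) (by simp [Fin.le_def]; omega)
        (by simp [Fin.le_def]; omega) (by simpa [Fin.lt_def])
      rw [hf, hf] at this
      simpa [List.getElem_take] using this
    · intro H i hi j hj hij
      simp only [Set.mem_Iic, Fin.le_def] at hi hj
      have := H i j (by simp; omega) (by simp; omega) hij
      rw [hf, hf]
      simpa [List.getElem_take] using this
  · rw [e', List.pairwise_iff_getElem]
    constructor
    · intro H i j hi hj hij
      simp only [List.length_drop, List.length_append, List.length_cons] at hi hj
      have := H (a := ⟨l₁.length + i, by omega⟩) (b := ⟨l₁.length + j, by omega⟩)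
        (by simp [Fin.le_def]; omega)
        (by simp [Fin.le_def]; omega) (by simpa [Fin.lt_def])
      rw [hf, hf] at this
      simpa only [List.getElem_drop] using this
    · intro H i hi j hj hij
      simp only [Set.mem_Ici, Fin.le_def] at hi hj
      rw [Fin.lt_def] at hij
      have := H (i - l₁.length) (j - l₁.length) (by simp; omega) (by simp; omega) (by omega)
      rw [hf, hf]
      simp only [List.getElem_drop] at this
      have e1 : l₁.length + (i - l₁.length) = i := by omega
      have e2 : l₁.length + (j - l₁.length) = j := by omega
      simpa only [e1, e2] using this

/-- The data `(N, A, B)` of a strongly unimodal sequence of size `n` and rank `m`: the peak is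
`N + 1`, and `A`, `B` are the sets of the terms before and after the peak. -/
def PeakData (m : ℤ) (n : ℕ) (x : ℕ × Finset ℕ × Finset ℕ) : Prop :=
  x.2.1 ⊆ Finset.Icc 1 x.1 ∧ x.2.2 ⊆ Finset.Icc 1 x.1 ∧ (x.2.2.card : ℤ) - x.2.1.card = m ∧
    x.1 + 1 + ∑ i ∈ x.2.1, i + ∑ i ∈ x.2.2, i = n

/-- The sequence with given peak and given sets of terms before and after the peak. -/
def peakList (x : ℕ × Finset ℕ × Finset ℕ) : List ℕ :=
  x.2.1.sort (· ≤ ·) ++ (x.1 + 1) :: x.2.2.sort (· ≥ ·)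

theorem pairwise_peakList {N : ℕ} {A B : Finset ℕ} (hA : A ⊆ Finset.Icc 1 N)
    (hB : B ⊆ Finset.Icc 1 N) :
    (A.sort (· ≤ ·) ++ [N + 1]).Pairwise (· < ·) ∧
      ((N + 1) :: B.sort (· ≥ ·)).Pairwise (· > ·) := by
  constructor
  · rw [List.pairwise_append]
    refine ⟨(Finset.sortedLT_sort A).pairwise, by simp, fun a ha b hb => ?_⟩
    have := Finset.mem_Icc.1 (hA ((Finset.mem_sort _).1 ha))
    simp at hb
    omega
  · rw [List.pairwise_cons]
    refine ⟨fun a ha => ?_, (Finset.sortedGT_sort B).pairwise⟩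
    have := Finset.mem_Icc.1 (hB ((Finset.mem_sort _).1 ha))
    omega

theorem sum_peakList (x : ℕ × Finset ℕ × Finset ℕ) :
    (peakList x).sum = x.1 + 1 + ∑ i ∈ x.2.1, i + ∑ i ∈ x.2.2, i := by
  have h : ∀ (A : Finset ℕ) (r : ℕ → ℕ → Prop) [DecidableRel r] [IsTrans ℕ r] [Std.Antisymm r]
      [Std.Total r], (A.sort r).sum = ∑ i ∈ A, i := fun A r _ _ _ _ => by
    rw [← Multiset.sum_coe, Finset.sort_eq, Finset.sum_val]; rfl
  rw [peakList, List.sum_append, List.sum_cons, h, h]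
  ring

/-- A list has at most one strict peak. -/
theorem peak_unique {l₁ l₂ l₁' l₂' : List ℕ} {p p' : ℕ} (h : l₁ ++ p :: l₂ = l₁' ++ p' :: l₂')
    (h1 : (l₁ ++ [p]).Pairwise (· < ·)) (h2 : (p :: l₂).Pairwise (· > ·))
    (h1' : (l₁' ++ [p']).Pairwise (· < ·)) (h2' : (p' :: l₂').Pairwise (· > ·)) :
    l₁ = l₁' ∧ p = p' ∧ l₂ = l₂' := by
  rw [List.pairwise_append] at h1 h1'
  rw [List.pairwise_cons] at h2 h2'
  have lt1 := fun a ha => h1.2.2 a ha p (by simp)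
  have lt1' := fun a ha => h1'.2.2 a ha p' (by simp)
  -- If the peaks sat at different positions, each would be strictly smaller than the other.
  rcases List.append_eq_append_iff.1 h with ⟨as, ha, hb⟩ | ⟨as, ha, hb⟩
  · cases as with
    | nil => simp_all
    | cons a as =>
      simp only [List.cons_append, List.cons.injEq] at hb
      have := lt1' p (by rw [ha, hb.1]; simp)
      have := h2.1 p' (by rw [hb.2]; simp)
      omega
  · cases as with
    | nil => simp_all
    | cons a as =>
      simp only [List.cons_append, List.cons.injEq] at hb
      have := lt1 p' (by rw [ha, hb.1]; simp)
      have := h2'.1 p (by rw [hb.2]; simp)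
      omega

/-- The composition attached to peak data. -/
def PeakData.toComposition {m : ℤ} {n : ℕ} {x : ℕ × Finset ℕ × Finset ℕ} (h : PeakData m n x) :
    Composition n where
  blocks := peakList x
  blocks_pos := by
    intro i hi
    simp only [peakList, List.mem_append, List.mem_cons, Finset.mem_sort] at hi
    rcases hi with hi | rfl | hi
    · exact (Finset.mem_Icc.1 (h.1 hi)).1
    · omega
    · exact (Finset.mem_Icc.1 (h.2.1 hi)).1
  blocks_sum := by rw [sum_peakList]; exact h.2.2.2

theorem PeakData.hasRank {m : ℤ} {n : ℕ} {x : ℕ × Finset ℕ × Finset ℕ} (h : PeakData m n x) :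
    HasRank h.toComposition m := by
  have hl : h.toComposition.length = x.2.1.card + 1 + x.2.2.card := by
    simp only [Composition.length, PeakData.toComposition, peakList]
    simp
    ring
  refine ⟨⟨x.2.1.card, by omega⟩, ?_, ?_⟩
  · rw [isPeak_iff h.toComposition (l₁ := x.2.1.sort (· ≤ ·)) rfl _ (by simp)]
    exact pairwise_peakList h.1 h.2.1
  · have := h.2.2.1
    simp only [hl]
    push_cast
    omega

/-- Strictly monotone lists are the sorted lists of their underlying sets, which gives surjectivity;
injectivity is `peak_unique`. -/
theorem u_eq_card (m : ℤ) (n : ℕ) : u m n = Nat.card {x // PeakData m n x} := by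
  symm
  refine Nat.card_eq_of_bijective (fun x => ⟨x.2.toComposition, x.2.hasRank⟩) ⟨?_, ?_⟩
  · rintro ⟨⟨N, A, B⟩, h⟩ ⟨⟨N', A', B'⟩, h'⟩ H
    have H' : peakList (N, A, B) = peakList (N', A', B') :=
      congrArg (fun c => c.1.blocks) H
    have k := pairwise_peakList h.1 h.2.1
    have k' := pairwise_peakList h'.1 h'.2.1
    obtain ⟨e1, e2, e3⟩ := peak_unique H' k.1 k.2 k'.1 k'.2
    have e1' := congrArg List.toFinset e1
    have e3' := congrArg List.toFinset e3
    simp only [Finset.sort_toFinset] at e1' e3'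
    simp only [Nat.add_right_cancel_iff] at e2
    simp [e1', e2, e3']
  · rintro ⟨c, k, hk, hr⟩
    have hkl : (k : ℕ) < c.blocks.length := by rw [c.blocks_length]; exact k.2
    set l₁ := c.blocks.take k with hl₁
    set l₂ := c.blocks.drop (k + 1) with hl₂
    set p := c.blocks[(k : ℕ)] with hp
    have hb : c.blocks = l₁ ++ p :: l₂ := by
      rw [hl₁, hl₂, hp, ← List.drop_eq_getElem_cons hkl, List.take_append_drop]
    have hlen : l₁.length = k := by simp [hl₁]
    obtain ⟨h1, h2⟩ := (isPeak_iff c hb k hlen.symm).1 hk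
    have h1' := List.pairwise_append.1 h1
    have h2' := List.pairwise_cons.1 h2
    have pos : ∀ i ∈ l₁ ++ p :: l₂, 0 < i := fun i hi => c.blocks_pos (hb ▸ hi)
    have ppos : 0 < p := pos p (by simp)
    obtain ⟨N, hN⟩ := Nat.exists_eq_add_one_of_ne_zero ppos.ne'
    have nd1 : l₁.Nodup := h1'.1.imp fun h => h.ne
    have nd2 : l₂.Nodup := h2'.2.imp fun h => h.ne'
    have s1 : l₁.toFinset.sort (· ≤ ·) = l₁ :=
      (List.toFinset_sort _ nd1).2 (h1'.1.imp fun h => h.le)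
    have s2 : l₂.toFinset.sort (· ≥ ·) = l₂ :=
      (List.toFinset_sort _ nd2).2 (h2'.2.imp fun h => h.le)
    have hpl : peakList (N, l₁.toFinset, l₂.toFinset) = c.blocks := by
      rw [peakList, s1, s2, hb, hN]
    have hpd : PeakData m n (N, l₁.toFinset, l₂.toFinset) := by
      refine ⟨fun i hi => ?_, fun i hi => ?_, ?_, ?_⟩
      · have hi : i ∈ l₁ := by simpa using hi
        have := h1'.2.2 i hi p (by simp)
        have := pos i (by simp [hi])
        simp; omega
      · have hi : i ∈ l₂ := by simpa using hi
        have := h2'.1 i hi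
        have := pos i (by simp [hi])
        simp; omega
      · simp only [List.toFinset_card_of_nodup nd1, List.toFinset_card_of_nodup nd2]
        have : c.length = l₁.length + 1 + l₂.length := by
          rw [← c.blocks_length, hb]; simp; ring
        omega
      · rw [← sum_peakList, hpl, c.blocks_sum]
    exact ⟨⟨_, hpd⟩, Subtype.ext (Composition.ext hpl)⟩

/-! ### Pairs of subsets and the finite triple product. -/

/-- The coefficient of `z ^ m` in `∏_{1 ≤ j ≤ N} (1 + z q^j) (1 + z⁻¹ q^j)`, as a sum over pairs of
subsets of `{1, …, N}`. -/
noncomputable def pairSeries (m : ℤ) (N : ℕ) : ℤ⟦X⟧ :=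
  ∑ A ∈ (Finset.Icc 1 N).powerset, ∑ B ∈ (Finset.Icc 1 N).powerset,
    if (B.card : ℤ) - A.card = m then X ^ (∑ i ∈ A, i + ∑ i ∈ B, i) else 0

theorem pairSeries_neg (m : ℤ) (N : ℕ) : pairSeries (-m) N = pairSeries m N := by
  rw [pairSeries, Finset.sum_comm, pairSeries]
  refine Finset.sum_congr rfl fun A _ => Finset.sum_congr rfl fun B _ => ?_
  rw [add_comm (∑ i ∈ A, i)]
  exact if_congr (by omega) rfl rfl

/-- The four terms record whether `N + 1` lies in `A`, in `B`, in both or in neither. -/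
theorem pairSeries_succ (m : ℤ) (N : ℕ) :
    pairSeries m (N + 1) = (1 + X ^ (2 * N + 2)) * pairSeries m N +
      X ^ (N + 1) * (pairSeries (m - 1) N + pairSeries (m + 1) N) := by
  have hI : Finset.Icc 1 (N + 1) = insert (N + 1) (Finset.Icc 1 N) := by
    ext i; simp; omega
  have hN : N + 1 ∉ Finset.Icc 1 N := by simp
  have hnot : ∀ A ∈ (Finset.Icc 1 N).powerset, N + 1 ∉ A := fun A hA h =>
    hN (Finset.mem_powerset.1 hA h)
  rw [pairSeries, hI]
  simp_rw [Finset.sum_powerset_insert hN]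
  simp_rw [pairSeries, add_mul, mul_add, one_mul, Finset.mul_sum, ← Finset.sum_add_distrib]
  refine Finset.sum_congr rfl fun A hA => Finset.sum_congr rfl fun B hB => ?_
  rw [Finset.card_insert_of_notMem (hnot A hA), Finset.card_insert_of_notMem (hnot B hB),
    Finset.sum_insert (hnot A hA), Finset.sum_insert (hnot B hB)]
  push_cast
  have e1 : ((B.card : ℤ) + 1 - A.card = m) ↔ ((B.card : ℤ) - A.card = m - 1) := by omega
  have e2 : ((B.card : ℤ) - (A.card + 1) = m) ↔ ((B.card : ℤ) - A.card = m + 1) := by omega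
  have e3 : ((B.card : ℤ) + 1 - (A.card + 1) = m) ↔ ((B.card : ℤ) - A.card = m) := by omega
  simp only [e1, e2, e3, mul_ite, mul_zero, ← pow_add]
  have f1 : 2 * N + 2 + (∑ i ∈ A, i + ∑ i ∈ B, i) =
    N + 1 + ∑ i ∈ A, i + (N + 1 + ∑ i ∈ B, i) := by ring
  have f2 : N + 1 + (∑ i ∈ A, i + ∑ i ∈ B, i) = ∑ i ∈ A, i + (N + 1 + ∑ i ∈ B, i) := by ring
  have f3 : N + 1 + ∑ i ∈ A, i + ∑ i ∈ B, i = ∑ i ∈ A, i + (N + 1 + ∑ i ∈ B, i) := by ring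
  rw [f1, f2, f3]
  ring

theorem pairSeries_zero (m : ℤ) : pairSeries m 0 = if m = 0 then 1 else 0 := by
  simp [pairSeries, eq_comm]

/-- The finite form of the Jacobi triple product, coefficientwise. -/
theorem pairSeries_add (m N : ℕ) :
    pairSeries m N + pairSeries (m + 1) N =
      X ^ (m * (m + 1) / 2) * qbinom (2 * N + 1) (N + m + 1) := by
  induction N generalizing m with
  | zero =>
    rcases m with _ | m
    · simp [pairSeries_zero]
    · rw [qbinom_eq_zero_of_lt (by omega), pairSeries_zero, pairSeries_zero, if_neg (by omega),
        if_neg (by omega)]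
      simp
  | succ N ih =>
    -- For `m = 0` the neighbour `-1` is outside the induction hypothesis; `pairSeries_neg` replaces
    -- it by `1`. Wherever the natural subtraction truncates, the adjacent binomial is zero.
    have hprev : X ^ (N + 1) * (pairSeries (m - 1) N + pairSeries m N) =
        X ^ (m * (m + 1) / 2) * (X ^ (2 * N + 2 - (N + m + 1)) * qbinom (2 * N + 1) (N + m)) := by
      rcases m with _ | m
      · have h := pairSeries_neg 1 N
        have h' := ih 0
        have hs := qbinom_symm N (N + 1)
        rw [show N + (N + 1) = 2 * N + 1 by ring] at hs
        have e : 2 * N + 2 - (N + 0 + 1) = N + 1 := by omega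
        simp only [Nat.cast_zero, zero_sub, zero_add, add_zero] at h' ⊢
        rw [h, add_comm (pairSeries 1 N), h', hs]
        simp only [add_zero] at e
        rw [e]
        simp
      · have h' := ih m
        push_cast
        rw [add_sub_cancel_right, h']
        rcases le_or_gt m N with hm | hm
        · rw [triangle_succ, ← mul_assoc, ← mul_assoc, ← pow_add, ← pow_add]
          congr 2
          omega
        · rw [← add_assoc N m 1, qbinom_eq_zero_of_lt (by omega)]; simp
    have hnext := ih (m + 1)
    push_cast at hnext
    -- Both Pascal rules bring the target down to three binomials with top `2N + 1`, matching the
    -- terms of `pairSeries_succ`.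
    have p1 : qbinom (2 * (N + 1) + 1) (N + 1 + m + 1) = qbinom (2 * N + 2) (N + m + 1) +
        X ^ (N + m + 2) * qbinom (2 * N + 2) (N + m + 2) := by
      rw [show N + 1 + m + 1 = N + m + 1 + 1 by ring]; exact qbinom_succ_succ _ _
    have pascal : ∀ k, k ≤ 2 * N + 1 → qbinom (2 * N + 2) (k + 1) =
        qbinom (2 * N + 1) (k + 1) + X ^ (2 * N + 1 - k) * qbinom (2 * N + 1) k := by
      intro k hk
      have := qbinom_succ_succ' (2 * N + 1 - k) k
      rwa [show 2 * N + 1 - k + k = 2 * N + 1 by omega] at this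
    have p2 : qbinom (2 * N + 2) (N + m + 1) = qbinom (2 * N + 1) (N + m + 1) +
        X ^ (2 * N + 2 - (N + m + 1)) * qbinom (2 * N + 1) (N + m) := by
      rcases le_or_gt (N + m) (2 * N + 1) with h | h
      · rw [pascal _ h]; congr 3; omega
      · simp [qbinom_eq_zero_of_lt, show 2 * N + 2 < N + m + 1 by omega,
          show 2 * N + 1 < N + m + 1 by omega, h]
    have p3 : X ^ (N + m + 2) * qbinom (2 * N + 2) (N + m + 2) =
        X ^ (N + m + 2) * qbinom (2 * N + 1) (N + m + 2) +
        X ^ (2 * N + 2) * qbinom (2 * N + 1) (N + m + 1) := by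
      rcases le_or_gt (N + m + 1) (2 * N + 1) with h | h
      · rw [pascal _ h, mul_add, ← mul_assoc, ← pow_add]
        congr 3
        omega
      · simp [qbinom_eq_zero_of_lt, show 2 * N + 2 < N + m + 2 by omega,
          show 2 * N + 1 < N + m + 2 by omega, h]
    rw [p1, p2, p3, pairSeries_succ, pairSeries_succ, add_sub_cancel_right]
    have hm := ih m
    rw [triangle_succ, show N + (m + 1) + 1 = N + m + 2 by ring, pow_add] at hnext
    linear_combination (1 + X ^ (2 * N + 2)) * hm + hprev + X ^ (N + 1) * hnext

/-! ### The formal identity for `U m`. -/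

theorem coeff_X_pow_mul_pairSeries (m : ℤ) {n N : ℕ} (hN : N < n) :
    coeff n (X ^ (N + 1) * pairSeries m N) =
      ∑ A ∈ (Finset.Icc 1 n).powerset, ∑ B ∈ (Finset.Icc 1 n).powerset,
        open Classical in if PeakData m n (N, A, B) then 1 else 0 := by
  classical
  have hsub : (Finset.Icc 1 N).powerset ⊆ (Finset.Icc 1 n).powerset :=
    Finset.powerset_mono.2 (Finset.Icc_subset_Icc_right hN.le)
  rw [← Finset.sum_subset hsub]
  · simp_rw [pairSeries, Finset.mul_sum, map_sum]
    refine Finset.sum_congr rfl fun A hA => ?_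
    rw [← Finset.sum_subset hsub]
    · refine Finset.sum_congr rfl fun B hB => ?_
      rw [mul_ite, mul_zero, ← pow_add]
      rw [Finset.mem_powerset] at hA hB
      simp only [PeakData, hA, hB, true_and, apply_ite (coeff (R := ℤ) n), coeff_X_pow, map_zero,
        ← add_assoc, ← ite_and, eq_comm]
    · intro B _ hB
      rw [if_neg]
      exact fun h => hB (Finset.mem_powerset.2 h.2.1)
  · intro A _ hA
    refine Finset.sum_eq_zero fun B _ => ?_
    rw [if_neg]
    exact fun h => hA (Finset.mem_powerset.2 h.1)

theorem u_eq_sum (m : ℤ) (n : ℕ) :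
    (u m n : ℤ) = ∑ N ∈ Finset.range n, coeff n (X ^ (N + 1) * pairSeries m N) := by
  classical
  rw [Finset.sum_congr rfl fun N hN => coeff_X_pow_mul_pairSeries m (Finset.mem_range.1 hN),
    u_eq_card, Nat.subtype_card ((Finset.range n ×ˢ (Finset.Icc 1 n).powerset ×ˢ
      (Finset.Icc 1 n).powerset).filter (PeakData m n))]
  · rw [Finset.card_filter, Finset.sum_product]
    simp_rw [Finset.sum_product]
    push_cast
    rfl
  · rintro ⟨N, A, B⟩
    rw [Finset.mem_filter, and_iff_right_iff_imp]
    intro h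
    have hN : N < n := by have := h.2.2.2; simp only at this; omega
    have hsub := Finset.Icc_subset_Icc_right (a := 1) hN.le
    simp only [Finset.mem_product, Finset.mem_range, Finset.mem_powerset]
    exact ⟨hN, h.1.trans hsub, h.2.1.trans hsub⟩

theorem hasSum_U (m : ℤ) : HasSum (fun N : ℕ => X ^ (N + 1) * pairSeries m N) (U m) := by
  rw [WithPiTopology.hasSum_iff_hasSum_coeff]
  intro n
  rw [U, coeff_mk, u_eq_sum]
  refine hasSum_sum_of_ne_finset_zero fun N hN => ?_
  exact X_pow_dvd_iff.1 (dvd_mul_right _ _) n (by simp at hN; omega)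

/-- Rank `m` forces at least `m` terms after the peak, each at least `1`. -/
theorem X_pow_dvd_U (m : ℕ) : X ^ m ∣ U m := by
  rw [X_pow_dvd_iff]
  intro n hn
  rw [U, coeff_mk, u_eq_card, Nat.cast_eq_zero]
  have : IsEmpty {x // PeakData m n x} := by
    refine ⟨fun ⟨⟨N, A, B⟩, h1, h2, h3, h4⟩ => ?_⟩
    simp only at h1 h2 h3 h4
    have : B.card ≤ ∑ i ∈ B, i := by
      simpa using Finset.card_nsmul_le_sum B id 1 fun i hi => (Finset.mem_Icc.1 (h2 hi)).1
    omega
  exact Nat.card_of_isEmpty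

/-- Terms with `N < m` vanish; for `N = k + m`, symmetry turns `[2N + 1; N + m + 1]` into `[2m + 1 +
2k; k]`. -/
theorem U_add (m : ℕ) :
    U m + U (m + 1) = X ^ (m * (m + 1) / 2) * (X ^ (m + 1) * binomSeries (2 * m + 1)) := by
  have h := (hasSum_U m).add (hasSum_U (m + 1))
  simp_rw [← mul_add, pairSeries_add] at h
  rw [← hasSum_nat_add_iff' m, Finset.sum_eq_zero, sub_zero] at h
  · have e : ∀ k, X ^ (k + m + 1) * (X ^ (m * (m + 1) / 2) *
        qbinom (2 * (k + m) + 1) (k + m + m + 1)) =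
        X ^ (m * (m + 1) / 2) * (X ^ (m + 1) * (X ^ k * qbinom (2 * m + 1 + 2 * k) k)) := by
      intro k
      have hs := qbinom_symm k (2 * m + k + 1)
      rw [show k + (2 * m + k + 1) = 2 * m + 1 + 2 * k by ring] at hs
      rw [show 2 * (k + m) + 1 = 2 * m + 1 + 2 * k by ring,
        show k + m + m + 1 = 2 * m + k + 1 by ring, hs]
      ring
    simp_rw [e] at h
    exact h.unique (((summable_binomSeries (2 * m + 1)).hasSum.mul_left
      (X ^ (m + 1))).mul_left (X ^ (m * (m + 1) / 2)))
  · intro N hN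
    rw [Finset.mem_range] at hN
    rw [qbinom_eq_zero_of_lt (by omega)]
    simp

theorem qPochInf_mul_U (m : ℕ) :
    qPochInf X X * U m = X ^ (m * (m + 1) / 2) * appellSeries m := by
  have step : ∀ m : ℕ, qPochInf X X * U m - X ^ (m * (m + 1) / 2) * appellSeries m =
      - (qPochInf X X * U (m + 1 : ℕ) -
        X ^ ((m + 1) * (m + 1 + 1) / 2) * appellSeries (m + 1)) := by
    intro m
    have h1 := U_add m
    have h2 := appellSeries_add m
    have h3 := qPochInf_mul_binomSeries (2 * m + 1)
    rw [triangle_succ, pow_add]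
    push_cast
    linear_combination qPochInf X X * h1 - X ^ (m * (m + 1) / 2) * h2 +
      X ^ (m * (m + 1) / 2) * X ^ (m + 1) * h3
  have iter : ∀ k m : ℕ, X ^ (m + k) ∣
      qPochInf X X * U m - X ^ (m * (m + 1) / 2) * appellSeries m := by
    intro k
    induction k with
    | zero =>
      exact fun m => dvd_sub ((X_pow_dvd_U m).mul_left _)
        ((pow_dvd_pow _ (le_triangle m)).mul_right _)
    | succ k ih =>
      intro m
      rw [step, dvd_neg, show m + (k + 1) = m + 1 + k by ring]
      exact ih (m + 1)
  exact sub_eq_zero.1 (eq_zero_of_forall_X_pow_dvd fun n =>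
    (pow_dvd_pow _ (by omega)).trans (iter n m))

/-! ### Partition numbers and the inverse of `(q)_∞`. -/

/-- The generating function of the partition numbers. -/
noncomputable def partitionSeries : ℤ⟦X⟧ := mk fun n => (Fintype.card (Nat.Partition n) : ℤ)

/-- The geometric series `1 / (1 - q^(i+1))`. -/
noncomputable def geomSeries (i : ℕ) : ℤ⟦X⟧ := mk fun n => if i + 1 ∣ n then 1 else 0

theorem one_sub_mul_geomSeries (i : ℕ) : (1 - X ^ (i + 1)) * geomSeries i = 1 := by
  ext n
  rw [sub_mul, one_mul, map_sub, coeff_X_pow_mul', geomSeries, coeff_mk, coeff_mk, coeff_one]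
  rcases Nat.eq_zero_or_pos n with rfl | hn
  · simp
  · split_ifs with h1 h2 h3 h4 h5 h6 <;> try omega
    · exact absurd ((Nat.dvd_sub_iff_left h2 dvd_rfl).2 h1) h3
    · exact absurd (Nat.le_of_dvd hn h1) h2
    · exact absurd ((Nat.dvd_sub_iff_left (by assumption) dvd_rfl).1 (by assumption)) h1

theorem hasProd_geomSeries : HasProd geomSeries partitionSeries := by
  have h := Nat.Partition.hasProd_powerSeriesMk_card_restricted ℤ (fun _ => True)
  have e : (PowerSeries.mk fun n => ((Nat.Partition.restricted n fun _ => True).card : ℤ)) =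
      partitionSeries := by
    rw [partitionSeries]
    congr 1
    funext n
    simp [Nat.Partition.restricted]
  rw [e] at h
  have hi : (fun i : ℕ => if True then ∑' j : ℕ, (X : ℤ⟦X⟧) ^ ((i + 1) * j) else 1) =
      geomSeries := by
    funext i
    rw [if_pos trivial]
    simp_rw [pow_mul]
    have h1 := WithPiTopology.one_sub_mul_tsum_pow_of_constantCoeff_eq_zero
      (f := (X : ℤ⟦X⟧) ^ (i + 1)) (by simp)
    have h2 := one_sub_mul_geomSeries i
    have h3 : (1 - (X : ℤ⟦X⟧) ^ (i + 1)) ≠ 0 := left_ne_zero_of_mul_eq_one h2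
    exact mul_left_cancel₀ h3 (h1.trans h2.symm)
  rw [hi] at h
  exact h

theorem qPochInf_mul_partitionSeries : qPochInf X X * partitionSeries = 1 := by
  have h := multipliable_qPochInf.hasProd.mul hasProd_geomSeries
  have e : (fun i : ℕ => (1 - (X : ℤ⟦X⟧) * X ^ i) * geomSeries i) = fun _ => 1 := by
    funext i
    rw [← pow_succ', one_sub_mul_geomSeries]
  rw [e] at h
  exact h.unique hasProd_one

theorem U_eq (m : ℕ) : U m = X ^ (m * (m + 1) / 2) * partitionSeries * appellSeries m := by
  have h := qPochInf_mul_U m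
  have h' := qPochInf_mul_partitionSeries
  linear_combination partitionSeries * h - U m * h'

theorem sum_pow_mul_one_sub {R : Type*} [CommRing R] (q : R) (E d n : ℕ) :
    (∑ j ∈ Finset.range n, q ^ (E + j * d)) * (1 - q ^ d) = q ^ E * (1 - q ^ (n * d)) := by
  have h := geom_sum_mul (q ^ d) n
  simp_rw [pow_add, ← Finset.mul_sum, mul_comm _ d, pow_mul]
  linear_combination (-q ^ E) * h

theorem isUnit_one_sub_X_pow {k : ℕ} (hk : k ≠ 0) : IsUnit (1 - (X : ℤ⟦X⟧) ^ k) := by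
  rw [isUnit_iff_constantCoeff]
  simp [hk]

theorem appellTerm_eq (m n : ℕ) : (-1 : ℤ⟦X⟧) ^ (n + 1) *
    X ^ ((n + 1) * (n + 1 + 1) / 2 + m * (n + 1)) * Ring.inverse (1 - X ^ (n + 1 + m))
      * (X ^ ((n + 1) * (n + 1 + m)) - 1) = appellTerm m n := by
  have h := sum_pow_mul_one_sub (X : ℤ⟦X⟧) ((n + 1) * (n + 1 + 1) / 2 + m * (n + 1))
    (n + 1 + m) (n + 1)
  have hu := Ring.inverse_mul_cancel _ (isUnit_one_sub_X_pow (k := n + 1 + m) (by omega))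
  rw [appellTerm]
  linear_combination (-1) ^ (n) * (∑ j ∈ Finset.range (n + 1),
    X ^ ((n + 1) * (n + 1 + 1) / 2 + m * (n + 1) + j * (n + 1 + m))) * hu -
      (-1) ^ n * Ring.inverse (1 - X ^ (n + 1 + m)) * h

/-! ### Evaluation of formal power series -/

/-- The power series `f` converges absolutely at `q`, with sum `v`. -/
structure EvalsTo {𝕜 : Type*} [RCLike 𝕜] (f : ℤ⟦X⟧) (q v : 𝕜) : Prop where
  summable : Summable fun n => ‖((coeff n f : ℤ) : 𝕜) * q ^ n‖
  hasSum : HasSum (fun n => ((coeff n f : ℤ) : 𝕜) * q ^ n) v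

namespace EvalsTo

variable {𝕜 : Type*} [RCLike 𝕜] {f g : ℤ⟦X⟧} {q v w : 𝕜}

theorem of_summable (h : Summable fun n => ‖((coeff n f : ℤ) : 𝕜) * q ^ n‖) :
    EvalsTo f q (∑' n, ((coeff n f : ℤ) : 𝕜) * q ^ n) :=
  ⟨h, h.of_norm.hasSum⟩

theorem mul (hf : EvalsTo f q v) (hg : EvalsTo g q w) : EvalsTo (f * g) q (v * w) := by
  have e : ∀ n, ((coeff n (f * g) : ℤ) : 𝕜) * q ^ n = ∑ kl ∈ Finset.HasAntidiagonal.antidiagonal n,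
      (((coeff kl.1 f : ℤ) : 𝕜) * q ^ kl.1) * (((coeff kl.2 g : ℤ) : 𝕜) * q ^ kl.2) := by
    intro n
    rw [coeff_mul, Int.cast_sum, Finset.sum_mul]
    refine Finset.sum_congr rfl fun kl hkl => ?_
    rw [← Finset.HasAntidiagonal.mem_antidiagonal.1 hkl]
    push_cast
    ring
  have hs := summable_norm_sum_mul_antidiagonal_of_summable_norm hf.summable hg.summable
  have ht := tsum_mul_tsum_eq_tsum_sum_antidiagonal_of_summable_norm hf.summable hg.summable
  simp_rw [← e] at hs ht
  rw [hf.hasSum.tsum_eq, hg.hasSum.tsum_eq] at ht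
  rw [ht]
  exact of_summable hs

theorem X_pow (k : ℕ) (q : 𝕜) : EvalsTo (X ^ k) q (q ^ k) := by
  have hz : ∀ n ∉ ({k} : Finset ℕ), ((coeff n ((X : ℤ⟦X⟧) ^ k) : ℤ) : 𝕜) * q ^ n = 0 := by
    intro n hn
    rw [coeff_X_pow, if_neg (by simpa using hn)]
    simp
  refine ⟨summable_of_ne_finset_zero (s := {k}) fun n hn => by rw [hz n hn, norm_zero], ?_⟩
  simpa [coeff_X_pow] using hasSum_sum_of_ne_finset_zero hz

theorem one (q : 𝕜) : EvalsTo 1 q 1 := by simpa using X_pow 0 q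

theorem sub (hf : EvalsTo f q v) (hg : EvalsTo g q w) : EvalsTo (f - g) q (v - w) := by
  have e : ∀ n, ((coeff n (f - g) : ℤ) : 𝕜) * q ^ n =
      ((coeff n f : ℤ) : 𝕜) * q ^ n - ((coeff n g : ℤ) : 𝕜) * q ^ n := fun n => by
    rw [map_sub]; push_cast; ring
  refine ⟨?_, ?_⟩
  · simp_rw [e]
    exact (hf.summable.add hg.summable).of_nonneg_of_le (fun _ => norm_nonneg _)
      fun _ => norm_sub_le _ _
  · simp_rw [e]
    exact hf.hasSum.sub hg.hasSum

theorem unique (hf : EvalsTo f q v) (hg : EvalsTo f q w) : v = w := hf.hasSum.unique hg.hasSum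

/-- Evaluation of a series of power series that converges absolutely. -/
theorem of_hasSum {f : ℕ → ℤ⟦X⟧} {F : ℤ⟦X⟧} {v : ℕ → 𝕜} {b : ℕ → ℝ} (hF : HasSum f F)
    (hv : ∀ n, EvalsTo (f n) q (v n)) (hb : Summable b)
    (hfb : ∀ n, ∑' k, ‖((coeff k (f n) : ℤ) : 𝕜) * q ^ k‖ ≤ b n) :
    Summable v ∧ EvalsTo F q (∑' n, v n) := by
  -- Fubini: rows of this double family sum to `v n`, columns to the terms of `F` at `q`.
  have hs : Summable fun x : ℕ × ℕ => ‖((coeff x.2 (f x.1) : ℤ) : 𝕜) * q ^ x.2‖ := by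
    rw [summable_prod_of_nonneg fun _ => norm_nonneg _]
    exact ⟨fun n => (hv n).summable,
      hb.of_nonneg_of_le (fun n => tsum_nonneg fun _ => norm_nonneg _) hfb⟩
  have h1 := hs.of_norm.hasSum.prod_fiberwise fun n => (hv n).hasSum
  have hs' : Summable fun x : ℕ × ℕ => ‖((coeff x.1 (f x.2) : ℤ) : 𝕜) * q ^ x.1‖ :=
    (Equiv.prodComm ℕ ℕ).summable_iff.1 hs
  have hcol : ∀ k, HasSum (fun n => ((coeff k (f n) : ℤ) : 𝕜) * q ^ k)
      (((coeff k F : ℤ) : 𝕜) * q ^ k) := fun k => by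
    have h := (WithPiTopology.hasSum_iff_hasSum_coeff ℤ).1 hF k
    exact (h.map (Int.castAddHom 𝕜) continuous_of_discreteTopology).mul_right _
  have h2 := (((Equiv.prodComm ℕ ℕ).hasSum_iff).2 hs.of_norm.hasSum).prod_fiberwise hcol
  refine ⟨h1.summable, ?_, ?_⟩
  · refine (((summable_prod_of_nonneg fun _ => norm_nonneg _).1 hs').2).of_nonneg_of_le
      (fun _ => norm_nonneg _) fun k => ?_
    rw [← (hcol k).tsum_eq]
    exact norm_tsum_le_tsum_norm (((summable_prod_of_nonneg fun _ => norm_nonneg _).1 hs').1 k)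
  · rw [h1.tsum_eq]
    exact h2

end EvalsTo

/-! ### Absolute convergence for `|q| < 1`. -/

section Evaluation

variable {𝕜 : Type*} [RCLike 𝕜] {q : 𝕜}

theorem one_sub_pow_ne_zero (hq : ‖q‖ < 1) {k : ℕ} (hk : k ≠ 0) : 1 - q ^ k ≠ 0 := by
  intro h
  have h1 : ‖q ^ k‖ < 1 := by
    rw [norm_pow]; exact pow_lt_one₀ (norm_nonneg _) hq hk
  rw [← sub_eq_zero.1 h] at h1
  simp at h1

theorem summable_norm_neg_mul_pow (hq : ‖q‖ < 1) : Summable fun j : ℕ => ‖-(q * q ^ j)‖ := by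
  simp only [norm_neg, norm_mul, norm_pow]
  exact (summable_geometric_of_lt_one (norm_nonneg _) hq).mul_left _

theorem multipliable_one_sub_mul_pow (hq : ‖q‖ < 1) : Multipliable fun j : ℕ => 1 - q * q ^ j := by
  simpa only [sub_eq_add_neg] using
    multipliable_one_add_of_summable (f := fun j : ℕ => -(q * q ^ j)) (summable_norm_neg_mul_pow hq)

theorem qPochInf_ne_zero (hq : ‖q‖ < 1) : qPochInf q q ≠ 0 := by
  have := tprod_one_add_ne_zero_of_summable (f := fun j : ℕ => -(q * q ^ j)) (fun j => by
    rw [← sub_eq_add_neg, ← pow_succ']; exact one_sub_pow_ne_zero hq (by omega))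
    (summable_norm_neg_mul_pow hq)
  simpa only [qPochInf, sub_eq_add_neg] using this

/-- The finite product `1 / (q; q)_K`. -/
noncomputable def geomProd (K : ℕ) : ℤ⟦X⟧ := ∏ i ∈ Finset.range K, geomSeries i

theorem coeff_geomSeries_nonneg (i n : ℕ) : 0 ≤ coeff n (geomSeries i) := by
  rw [geomSeries, coeff_mk]; split_ifs <;> simp

theorem coeff_geomProd_nonneg (K n : ℕ) : 0 ≤ coeff n (geomProd K) := by
  induction K generalizing n with
  | zero => rw [geomProd, Finset.prod_range_zero, coeff_one]; split_ifs <;> simp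
  | succ K ih =>
    rw [geomProd, Finset.prod_range_succ, coeff_mul]
    exact Finset.sum_nonneg fun x _ => mul_nonneg (ih _) (coeff_geomSeries_nonneg _ _)

/-- The new factor has constant term `1` and nonnegative coefficients. The resulting monotonicity
supplies the domination in `evalsTo_partitionSeries`. -/
theorem coeff_geomProd_le_succ (K n : ℕ) : coeff n (geomProd K) ≤ coeff n (geomProd (K + 1)) := by
  rw [geomProd, geomProd, Finset.prod_range_succ, coeff_mul]
  refine le_trans (le_of_eq ?_) (Finset.single_le_sum
    (fun x _ => mul_nonneg (coeff_geomProd_nonneg K _) (coeff_geomSeries_nonneg K x.2))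
    (a := (n, 0)) (Finset.HasAntidiagonal.mem_antidiagonal.2 (add_zero n)))
  simp [geomSeries, geomProd]

theorem tendsto_coeff_geomProd (n : ℕ) :
    Tendsto (fun K => coeff n (geomProd K)) atTop (𝓝 (coeff n partitionSeries)) :=
  ((WithPiTopology.continuous_coeff ℤ n).tendsto _).comp hasProd_geomSeries.tendsto_prod_nat

theorem coeff_geomProd_le (K n : ℕ) : coeff n (geomProd K) ≤ coeff n partitionSeries :=
  (monotone_nat_of_le_succ fun K => coeff_geomProd_le_succ K n).ge_of_tendsto
    (tendsto_coeff_geomProd n) K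

theorem norm_coeff_mul_pow {f : ℤ⟦X⟧} (h : ∀ n, 0 ≤ coeff n f) (q : 𝕜) (n : ℕ) :
    ‖((coeff n f : ℤ) : 𝕜) * q ^ n‖ = (coeff n f : ℤ) * ‖q‖ ^ n := by
  obtain ⟨a, ha⟩ := Int.eq_ofNat_of_zero_le (h n)
  rw [ha]
  simp

theorem evalsTo_geomSeries (hq : ‖q‖ < 1) (i : ℕ) :
    EvalsTo (geomSeries i) q (1 - q * q ^ i)⁻¹ := by
  have hs : Summable fun n => ‖((coeff n (geomSeries i) : ℤ) : 𝕜) * q ^ n‖ := by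
    refine (summable_geometric_of_lt_one (norm_nonneg q) hq).of_nonneg_of_le
      (fun _ => norm_nonneg _) fun n => ?_
    rw [norm_coeff_mul_pow (coeff_geomSeries_nonneg i), geomSeries, coeff_mk]
    split_ifs <;> simp
  have h := EvalsTo.of_summable hs
  have h1 := (((EvalsTo.one q).sub (EvalsTo.X_pow (i + 1) q)).mul h)
  rw [one_sub_mul_geomSeries, pow_succ' q] at h1
  rwa [eq_inv_of_mul_eq_one_right (h1.unique (EvalsTo.one q))] at h

theorem evalsTo_geomProd (hq : ‖q‖ < 1) (K : ℕ) :
    EvalsTo (geomProd K) q (∏ i ∈ Finset.range K, (1 - q * q ^ i)⁻¹) := by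
  induction K with
  | zero => simpa [geomProd] using EvalsTo.one q
  | succ K ih =>
    rw [geomProd, Finset.prod_range_succ, Finset.prod_range_succ]
    exact ih.mul (evalsTo_geomSeries hq K)

theorem tendsto_prod_inv (hq : ‖q‖ < 1) :
    Tendsto (fun K => ∏ i ∈ Finset.range K, (1 - q * q ^ i)⁻¹) atTop (𝓝 (qPochInf q q)⁻¹) := by
  simp_rw [Finset.prod_inv_distrib]
  exact ((multipliable_one_sub_mul_pow hq).hasProd.tendsto_prod_nat).inv₀ (qPochInf_ne_zero hq)

theorem summable_partitionSeries {r : ℝ} (h0 : 0 ≤ r) (hr : r < 1) :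
    Summable fun n => ((coeff n partitionSeries : ℤ) : ℝ) * r ^ n := by
  have hr' : ‖r‖ < 1 := by rwa [Real.norm_of_nonneg h0]
  refine summable_of_sum_le (c := (qPochInf r r)⁻¹) (fun n => ?_) fun s => ?_
  · exact mul_nonneg (by simp [partitionSeries]) (pow_nonneg h0 n)
  -- For each `K`, a finite part of a nonnegative series is at most the finite product; then `K →
  -- ∞`.
  · refine le_of_tendsto_of_tendsto' (tendsto_finsetSum s fun n _ =>
      ((continuous_of_discreteTopology (f := fun z : ℤ => (z : ℝ))).tendsto _ |>.comp
        (tendsto_coeff_geomProd n)).mul_const (r ^ n)) (tendsto_prod_inv hr') fun K => ?_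
    exact sum_le_hasSum s (fun n _ => mul_nonneg (Int.cast_nonneg (coeff_geomProd_nonneg K n))
      (pow_nonneg h0 n)) (evalsTo_geomProd hr' K).hasSum

theorem evalsTo_partitionSeries (hq : ‖q‖ < 1) :
    EvalsTo partitionSeries q (qPochInf q q)⁻¹ := by
  have hs := summable_partitionSeries (norm_nonneg q) hq
  have h := EvalsTo.of_summable (f := partitionSeries) (q := q) (by
    simpa only [norm_coeff_mul_pow (f := partitionSeries) fun n => by simp [partitionSeries]])
  have ht : Tendsto (fun K => ∑' n, ((coeff n (geomProd K) : ℤ) : 𝕜) * q ^ n) atTop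
      (𝓝 (∑' n, ((coeff n partitionSeries : ℤ) : 𝕜) * q ^ n)) := by
    refine tendsto_tsum_of_dominated_convergence hs (fun n => ?_) (Eventually.of_forall
      fun K n => ?_)
    · exact ((continuous_of_discreteTopology (f := fun z : ℤ => (z : 𝕜))).tendsto _ |>.comp
        (tendsto_coeff_geomProd n)).mul_const (q ^ n)
    · rw [norm_coeff_mul_pow (coeff_geomProd_nonneg K)]
      exact mul_le_mul_of_nonneg_right (Int.cast_le.2 (coeff_geomProd_le K n)) (by positivity)
  simp_rw [(evalsTo_geomProd hq _).hasSum.tsum_eq] at ht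
  rwa [tendsto_nhds_unique ht (tendsto_prod_inv hq)] at h

theorem evalsTo_appellTerm (q : 𝕜) (m n : ℕ) :
    EvalsTo (appellTerm m n) q ((-1) ^ n * ∑ j ∈ Finset.range (n + 1),
      q ^ ((n + 1) * (n + 2) / 2 + m * (n + 1) + j * (n + 1 + m))) ∧
    ∑' k, ‖((coeff k (appellTerm m n) : ℤ) : 𝕜) * q ^ k‖ ≤ ∑ j ∈ Finset.range (n + 1),
      ‖q‖ ^ ((n + 1) * (n + 2) / 2 + m * (n + 1) + j * (n + 1 + m)) := by
  set e : ℕ → ℕ := fun j => (n + 1) * (n + 2) / 2 + m * (n + 1) + j * (n + 1 + m) with he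
  have hc : ∀ k, ((coeff k (appellTerm m n) : ℤ) : 𝕜) * q ^ k = (-1) ^ n *
      ∑ j ∈ Finset.range (n + 1), ((coeff k ((X : ℤ⟦X⟧) ^ e j) : ℤ) : 𝕜) * q ^ k := by
    intro k
    rw [appellTerm, show ((-1 : ℤ⟦X⟧) ^ n) = C ((-1 : ℤ) ^ n) by simp, coeff_C_mul, map_sum,
      ← Finset.sum_mul]
    push_cast
    ring
  have hle : ∀ k, ‖((coeff k (appellTerm m n) : ℤ) : 𝕜) * q ^ k‖ ≤
      ∑ j ∈ Finset.range (n + 1), ‖((coeff k ((X : ℤ⟦X⟧) ^ e j) : ℤ) : 𝕜) * q ^ k‖ := by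
    intro k
    rw [hc, norm_mul, norm_pow, norm_neg, norm_one, one_pow, one_mul]
    exact norm_sum_le _ _
  have hX : ∀ j, HasSum (fun k => ‖((coeff k ((X : ℤ⟦X⟧) ^ e j) : ℤ) : 𝕜) * q ^ k‖) (‖q‖ ^ e j) := by
    intro j
    have h := (EvalsTo.X_pow (e j) ‖q‖).hasSum
    have hn : ∀ k, 0 ≤ coeff k ((X : ℤ⟦X⟧) ^ e j) := fun k => by
      rw [coeff_X_pow]; split_ifs <;> simp
    simpa only [norm_coeff_mul_pow hn] using h
  have hsum := hasSum_sum fun j (_ : j ∈ Finset.range (n + 1)) => hX j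
  have hs : Summable fun k => ‖((coeff k (appellTerm m n) : ℤ) : 𝕜) * q ^ k‖ :=
    hsum.summable.of_nonneg_of_le (fun _ => norm_nonneg _) hle
  refine ⟨⟨hs, ?_⟩, ?_⟩
  · simp_rw [hc]
    exact (hasSum_sum fun j _ => (EvalsTo.X_pow (e j) q).hasSum).mul_left _
  · rw [← hsum.tsum_eq]
    exact hs.tsum_le_tsum hle hsum.summable

theorem evalsTo_appellSeries (hq : ‖q‖ < 1) (m : ℕ) :
    Summable (fun n : ℕ => (-1) ^ n * ∑ j ∈ Finset.range (n + 1),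
      q ^ ((n + 1) * (n + 2) / 2 + m * (n + 1) + j * (n + 1 + m))) ∧
    EvalsTo (appellSeries m) q (∑' n : ℕ, (-1) ^ n * ∑ j ∈ Finset.range (n + 1),
      q ^ ((n + 1) * (n + 2) / 2 + m * (n + 1) + j * (n + 1 + m))) := by
  -- Term `n` consists of `n + 1` monomials, all of degree at least `n + 1`.
  have hb : Summable fun n : ℕ => ((n + 1 : ℕ) : ℝ) ^ 1 * ‖q‖ ^ (n + 1) :=
    (summable_nat_add_iff (f := fun n : ℕ => (n : ℝ) ^ 1 * ‖q‖ ^ n) 1).2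
      (summable_pow_mul_geometric_of_norm_lt_one 1 (by simpa using hq))
  refine EvalsTo.of_hasSum (summable_appellTerm m).hasSum
    (fun n => (evalsTo_appellTerm q m n).1) hb fun n => (evalsTo_appellTerm q m n).2.trans ?_
  rw [pow_one, ← nsmul_eq_mul]
  refine (Finset.sum_le_card_nsmul _ _ (‖q‖ ^ (n + 1)) fun j _ => ?_).trans_eq (by simp)
  refine pow_le_pow_of_le_one (norm_nonneg _) hq.le ?_
  have : n + 1 ≤ (n + 1) * (n + 2) / 2 := le_triangle (n + 1)
  omega

theorem appellTerm_eval_eq (hq : ‖q‖ < 1) (m n : ℕ) :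
    (-1) ^ (n + 1) * q ^ ((n + 1) * (n + 1 + 1) / 2 + m * (n + 1)) / (1 - q ^ (n + 1 + m)) *
      (q ^ ((n + 1) * (n + 1 + m)) - 1) = (-1) ^ n * ∑ j ∈ Finset.range (n + 1),
      q ^ ((n + 1) * (n + 2) / 2 + m * (n + 1) + j * (n + 1 + m)) := by
  have h := sum_pow_mul_one_sub q ((n + 1) * (n + 1 + 1) / 2 + m * (n + 1)) (n + 1 + m) (n + 1)
  have h0 := one_sub_pow_ne_zero hq (k := n + 1 + m) (by omega)
  rw [div_mul_eq_mul_div, div_eq_iff h0]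
  linear_combination -(-1) ^ n * h

end Evaluation

/-! ### The initial coefficients. -/

theorem u_eq_card_partition (m n : ℕ) (hn : n ≤ m + 1) :
    u m ((m + 2) * (m + 1) / 2 + n) = Fintype.card (Nat.Partition n) := by
  -- The second term of the series starts at degree `3 + 2m`. Relative to the leading `X ^ (m + 1)`
  -- the error has order `m + 2`, whence the range `n ≤ m + 1`.
  have hS : X ^ (2 * m + 3) ∣ appellSeries m - X ^ (m + 1) := by
    rw [appellSeries, (summable_appellTerm m).tsum_eq_zero_add, appellTerm_zero,
      add_sub_cancel_left, X_pow_dvd_iff]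
    intro d hd
    have hs := ((summable_nat_add_iff 1).2 (summable_appellTerm m)).hasSum
    refine ((WithPiTopology.hasSum_iff_hasSum_coeff ℤ).1 hs d).unique ?_
    convert hasSum_zero with k
    refine X_pow_dvd_iff.1 (X_pow_dvd_appellTerm m (k + 1)) d (hd.trans_le ?_)
    rw [triangle_succ]
    have := le_triangle (k + 1)
    nlinarith
  obtain ⟨g, hg⟩ := hS
  have hU : U m = X ^ ((m + 2) * (m + 1) / 2) * (partitionSeries +
      X ^ (m + 2) * (partitionSeries * g)) := by
    rw [U_eq, eq_add_of_sub_eq hg, mul_comm (m + 2), triangle_succ]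
    ring
  have h := congrArg (coeff ((m + 2) * (m + 1) / 2 + n)) hU
  rw [add_comm _ n, coeff_X_pow_mul, map_add,
    X_pow_dvd_iff.1 (dvd_mul_right (X ^ (m + 2)) _) n (by omega), add_zero, U, coeff_mk,
    partitionSeries, coeff_mk] at h
  rw [add_comm]
  exact_mod_cast h

end StronglyUnimodal

/-- For `m ≥ 0`: the generating function identity for `U_m(q)` in the ring of formal power series
(with coefficientwise convergence; `Ring.inverse` is the multiplicative inverse, all denominators
being units), the same identity for complex `q` with `|q| < 1`, and the resulting equality with
partition numbers. -/
theorem theorem1p1 (m : ℕ) :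
    (Multipliable (fun j : ℕ => 1 - (PowerSeries.X : ℤ⟦X⟧) * PowerSeries.X ^ j) ∧
      IsUnit (qPochInf (PowerSeries.X : ℤ⟦X⟧) PowerSeries.X) ∧
      (∀ n : ℕ+, IsUnit (1 - (PowerSeries.X : ℤ⟦X⟧) ^ ((n : ℕ) + m))) ∧
      Summable (fun n : ℕ+ =>
        (-1 : ℤ⟦X⟧) ^ (n : ℕ) * PowerSeries.X ^ ((n : ℕ) * (n + 1) / 2 + m * n)
          * Ring.inverse (1 - PowerSeries.X ^ ((n : ℕ) + m))
          * (PowerSeries.X ^ ((n : ℕ) * (n + m)) - 1)) ∧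
      U m = PowerSeries.X ^ (m * (m + 1) / 2) * Ring.inverse (qPochInf PowerSeries.X PowerSeries.X)
        * ∑' n : ℕ+,
            (-1 : ℤ⟦X⟧) ^ (n : ℕ) * PowerSeries.X ^ ((n : ℕ) * (n + 1) / 2 + m * n)
              * Ring.inverse (1 - PowerSeries.X ^ ((n : ℕ) + m))
              * (PowerSeries.X ^ ((n : ℕ) * (n + m)) - 1)) ∧
    (∀ q : ℂ, ‖q‖ < 1 →
      Multipliable (fun j : ℕ => 1 - q * q ^ j) ∧
      qPochInf q q ≠ 0 ∧
      Summable (fun n : ℕ+ =>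
        (-1) ^ (n : ℕ) * q ^ ((n : ℕ) * (n + 1) / 2 + m * n) / (1 - q ^ ((n : ℕ) + m))
          * (q ^ ((n : ℕ) * (n + m)) - 1)) ∧
      HasSum (fun n : ℕ+ => (u m n : ℂ) * q ^ (n : ℕ))
        (q ^ (m * (m + 1) / 2) / qPochInf q q
          * ∑' n : ℕ+,
              (-1) ^ (n : ℕ) * q ^ ((n : ℕ) * (n + 1) / 2 + m * n) / (1 - q ^ ((n : ℕ) + m))
                * (q ^ ((n : ℕ) * (n + m)) - 1))) ∧
    ∀ n : ℕ, n ≤ m + 1 →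
      u m ((m + 2) * (m + 1) / 2 + n) = Fintype.card (Nat.Partition n) := by
  have hunit : IsUnit (qPochInf (PowerSeries.X : ℤ⟦X⟧) PowerSeries.X) :=
    IsUnit.of_mul_eq_one _ qPochInf_mul_partitionSeries
  refine ⟨⟨multipliable_qPochInf, hunit,
    fun n => isUnit_one_sub_X_pow (by have := n.pos; omega), ?_, ?_⟩, fun q hq =>
    ⟨multipliable_one_sub_mul_pow hq, qPochInf_ne_zero hq, ?_, ?_⟩, u_eq_card_partition m⟩
  · refine (summable_pnat_iff_summable_succ (f := fun n => (-1 : ℤ⟦X⟧) ^ n *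
      PowerSeries.X ^ (n * (n + 1) / 2 + m * n) * Ring.inverse (1 - PowerSeries.X ^ (n + m)) * (PowerSeries.X ^ (n * (n + m)) - 1))).2 ?_
    simp_rw [appellTerm_eq]
    exact summable_appellTerm m
  · rw [tsum_pnat_eq_tsum_succ (f := fun n => (-1 : ℤ⟦X⟧) ^ n *
      PowerSeries.X ^ (n * (n + 1) / 2 + m * n) * Ring.inverse (1 - PowerSeries.X ^ (n + m)) * (PowerSeries.X ^ (n * (n + m)) - 1))]
    simp_rw [appellTerm_eq]
    have hinv : Ring.inverse (qPochInf (PowerSeries.X : ℤ⟦X⟧) PowerSeries.X) = partitionSeries := by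
      have h := Ring.inverse_mul_cancel _ hunit
      linear_combination partitionSeries * h -
        Ring.inverse (qPochInf (PowerSeries.X : ℤ⟦X⟧) PowerSeries.X) * qPochInf_mul_partitionSeries
    rw [hinv]
    exact U_eq m
  · refine (summable_pnat_iff_summable_succ (f := fun n => (-1 : ℂ) ^ n * q ^ (n * (n + 1) / 2 + m * n)
      / (1 - q ^ (n + m)) * (q ^ (n * (n + m)) - 1))).2 ?_
    simp_rw [appellTerm_eval_eq hq]
    exact (evalsTo_appellSeries hq m).1
  · rw [tsum_pnat_eq_tsum_succ (f := fun n => (-1 : ℂ) ^ n * q ^ (n * (n + 1) / 2 + m * n)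
      / (1 - q ^ (n + m)) * (q ^ (n * (n + m)) - 1))]
    simp_rw [appellTerm_eval_eq hq]
    rw [hasSum_pnat_iff_hasSum_succ (f := fun n => (u m n : ℂ) * q ^ n)]
    have h := (((EvalsTo.X_pow (m * (m + 1) / 2) q).mul (evalsTo_partitionSeries hq)).mul
      (evalsTo_appellSeries hq m).2).hasSum
    -- The index `0` is dropped to match a sum over `ℕ+`; its term is zero by `u_zero`.
    rw [← U_eq, ← hasSum_nat_add_iff' 1] at h
    simpa [U, u_zero, div_eq_mul_inv] using h
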